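/- Let $0<\varepsilon<1$ be fixed. There are a constant $c>0$ and an integer $N$, depending only on $\varepsilon$, such that for all integers $d\ge 2$ and $n\ge 2$ with $d^n\ge N$ the following holds. Let $|\psi\rangle=U|\psi_0\rangle$ be a Haar-random pure state on $(\mathbb{C}^d)^{\otimes n}$, where $|\psi_0\rangle$ is any fixed unit vector and $U$ is drawn from the normalized Haar measure on the unitary group of $(\mathbb{C}^d)^{\otimes n}$. Let $\mathcal{M}_n$ be the set of fully product pure states $|\phi_1\rangle\otimes\cdots\otimes|\phi_n\rangle$ with unit vectors $|\phi_i\rangle\in\mathbb{C}^d$, and for density operators let $d_{\mathrm{tr}}(\rho,\sigma)=\tfrac12\|\rho-\sigma\|_1$, where $\|X\|_1=\operatorname{tr}\sqrt{X^\dagger X}$; for pure states, $d_{\mathrm{tr}}(\phi,\psi)$ is the trace distance between $|\phi\rangle\langle\phi|$ and $|\psi\rangle\langle\psi|$. Then $$\Pr\left[\exists\,\phi\in\mathcal{M}_n:\ d_{\mathrm{tr}}(\phi,\psi)\le\varepsilon\right]\le e^{-c\,d^n}.$$ -/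

import Mathlib

open scoped Matrix

namespace ProductTesting

/-- The space `(ℂ^d)^{⊗ n}` of (unnormalized) pure `n`-qudit states, written in the computational
basis `|x₁⟩ ⊗ ⋯ ⊗ |xₙ⟩`, which is indexed by the strings `x : Fin n → Fin d`. -/
abbrev QuditSpace (n d : ℕ) : Type := EuclideanSpace ℂ (Fin n → Fin d)

/-- The elementary tensor `|φ₁⟩ ⊗ ⋯ ⊗ |φₙ⟩`: its amplitude at the string `x` is `∏ i, φᵢ(xᵢ)`. -/
noncomputable def tensorState {n d : ℕ} (φ : Fin n → EuclideanSpace ℂ (Fin d)) :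
    QuditSpace n d :=
  WithLp.toLp 2 fun x => ∏ i, φ i (x i)

/-- The set `𝓜ₙ` of multipartite product (fully product) pure states: all `|φ₁⟩ ⊗ ⋯ ⊗ |φₙ⟩` with
unit vectors `|φᵢ⟩ ∈ ℂ^d`. -/
def multipartiteProduct (n d : ℕ) : Set (QuditSpace n d) :=
  {ψ | ∃ φ : Fin n → EuclideanSpace ℂ (Fin d), (∀ i, ‖φ i‖ = 1) ∧ ψ = tensorState φ}

section States

variable {ι : Type*} [Fintype ι] [DecidableEq ι]

/-- The projector `|ψ⟩⟨ψ|` of a pure state. -/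
noncomputable def projector (ψ : EuclideanSpace ℂ ι) : Matrix ι ι ℂ :=
  Matrix.vecMulVec ψ.ofLp (star ψ.ofLp)

/-- The trace norm `‖X‖₁ = tr √(X† X)`. The square root is taken by functional calculus. -/
noncomputable def traceNorm (X : Matrix ι ι ℂ) : ℝ :=
  (Matrix.trace (cfc Real.sqrt (Xᴴ * X))).re

/-- The trace distance `½ ‖ρ - σ‖₁`. -/
noncomputable def traceDist (ρ σ : Matrix ι ι ℂ) : ℝ :=
  (1 / 2) * traceNorm (ρ - σ)

/-- A pure state `ψ` is `ε`-close to a set `P` of pure states if some element of `P` is at trace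
distance at most `ε` from `ψ`. -/
def IsClose (ε : ℝ) (P : Set (EuclideanSpace ℂ ι)) (ψ : EuclideanSpace ℂ ι) : Prop :=
  ∃ φ ∈ P, traceDist (projector φ) (projector ψ) ≤ ε

/-- The state `U |ψ⟩`. -/
noncomputable def applyUnitary (U : Matrix.unitaryGroup ι ℂ) (ψ : EuclideanSpace ℂ ι) :
    EuclideanSpace ℂ ι :=
  WithLp.toLp 2 ((U : Matrix ι ι ℂ) *ᵥ ψ.ofLp)

end States

section Haar

variable (ι : Type*) [Fintype ι] [DecidableEq ι]

theorem isCompact_unitaryGroup :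
    IsCompact (Matrix.unitaryGroup ι ℂ : Set (Matrix ι ι ℂ)) := by
  have hK : IsCompact (Set.univ.pi fun _ : ι => Set.univ.pi fun _ : ι =>
      Metric.closedBall (0 : ℂ) 1) :=
    isCompact_univ_pi fun _ => isCompact_univ_pi fun _ => isCompact_closedBall _ _
  refine IsCompact.of_isClosed_subset (X := Matrix ι ι ℂ) hK isClosed_unitary ?_
  intro U hU i _ j _
  simpa using entry_norm_bound_of_unitary hU i j

instance instCompactSpaceUnitaryGroup : CompactSpace (Matrix.unitaryGroup ι ℂ) :=
  isCompact_iff_compactSpace.mp (isCompact_unitaryGroup ι)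

noncomputable instance instMeasurableSpaceUnitaryGroup : MeasurableSpace (Matrix.unitaryGroup ι ℂ) :=
  borel _

instance instBorelSpaceUnitaryGroup : BorelSpace (Matrix.unitaryGroup ι ℂ) := ⟨rfl⟩

/-- The Haar measure on the unitary group, normalized to total mass one. -/
noncomputable def haarUnitary : MeasureTheory.Measure (Matrix.unitaryGroup ι ℂ) :=
  MeasureTheory.Measure.haarMeasure ⊤

instance instIsProbabilityMeasureHaarUnitary :
    MeasureTheory.IsProbabilityMeasure (haarUnitary ι) :=
  ⟨by simpa [haarUnitary] using MeasureTheory.Measure.haarMeasure_self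
        (K₀ := (⊤ : TopologicalSpace.PositiveCompacts (Matrix.unitaryGroup ι ℂ)))⟩

end Haar

end ProductTesting

namespace ProductTesting

/-! ### Trace distance and fidelity of pure states. -/

section States

variable {ι : Type*}

/-! A product state has only `d * n` complex parameters, whereas a Haar-random state has overlap of
order `d ^ (-n / 2)` with any fixed state; a union bound over a net therefore wins. Put `s = √(1 - ε
^ 2)`. Closeness `ε` to a product state forces overlap at least `s` with it
(`one_sub_sq_le_of_traceDist_le`). Rounding each tensor factor to a net of unit vectors
(`exists_unit_net`, `norm_tensorState_sub_le`) costs at most `s / 2`, so some net state has overlap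
at least `s / 2`. Each does so with probability at most `4 * exp (-s ^ 2 * d ^ n / 16)`
(`haarUnitary_le_norm_inner`), and the net has only `exp (o (d ^ n))` points (`exists_net_card_le`).
The tail bound needs neither Lévy's lemma nor the explicit law of the overlap. By invariance the
fixed state may be replaced by a flat state with random signs; for each fixed `U` the overlap is
then a Rademacher sum, controlled by Hoeffding (`card_signs_le`). -/

theorem dotProduct_star_self_of_norm_eq_one [Fintype ι] {φ : EuclideanSpace ℂ ι} (hφ : ‖φ‖ = 1) :
    star φ.ofLp ⬝ᵥ φ.ofLp = 1 := by
  rw [dotProduct_comm, ← EuclideanSpace.inner_eq_star_dotProduct, inner_self_eq_norm_sq_to_K, hφ]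
  simp

theorem projector_mul_projector [Fintype ι] [DecidableEq ι] (φ ψ : EuclideanSpace ℂ ι) :
    projector φ * projector ψ =
      inner ℂ φ ψ • Matrix.vecMulVec φ.ofLp (star ψ.ofLp) := by
  rw [projector, projector, Matrix.vecMulVec_mul_vecMulVec, Matrix.vecMulVec_smul,
    EuclideanSpace.inner_eq_star_dotProduct, dotProduct_comm]

theorem projector_mul_self [Fintype ι] [DecidableEq ι] {φ : EuclideanSpace ℂ ι} (hφ : ‖φ‖ = 1) :
    projector φ * projector φ = projector φ := by
  rw [projector_mul_projector, inner_self_eq_norm_sq_to_K, hφ]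
  simp [projector]

theorem projector_mul_projector_mul_self [Fintype ι] [DecidableEq ι] (φ ψ : EuclideanSpace ℂ ι) :
    projector φ * projector ψ * projector φ =
      ((‖inner ℂ φ ψ‖ ^ 2 : ℝ) : ℂ) • projector φ := by
  rw [projector_mul_projector, projector, Matrix.smul_mul, Matrix.vecMulVec_mul_vecMulVec,
    Matrix.vecMulVec_smul, smul_smul, dotProduct_comm (star ψ.ofLp),
    ← EuclideanSpace.inner_eq_star_dotProduct, ← inner_conj_symm ψ φ, Complex.mul_conj,
    Complex.normSq_eq_norm_sq]

theorem trace_projector [Fintype ι] [DecidableEq ι] {φ : EuclideanSpace ℂ ι} (hφ : ‖φ‖ = 1) :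
    (projector φ).trace = 1 := by
  rw [projector, Matrix.trace_vecMulVec, dotProduct_comm, dotProduct_star_self_of_norm_eq_one hφ]

theorem trace_projector_mul_projector [Fintype ι] [DecidableEq ι] (φ ψ : EuclideanSpace ℂ ι) :
    (projector φ * projector ψ).trace = ((‖inner ℂ φ ψ‖ ^ 2 : ℝ) : ℂ) := by
  rw [projector_mul_projector, Matrix.trace_smul, Matrix.trace_vecMulVec,
    ← EuclideanSpace.inner_eq_star_dotProduct, ← inner_conj_symm ψ φ, smul_eq_mul,
    Complex.mul_conj, Complex.normSq_eq_norm_sq]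

theorem isHermitian_projector (φ : EuclideanSpace ℂ ι) :
    (projector φ)ᴴ = projector φ := by
  rw [projector, Matrix.conjTranspose_vecMulVec, star_star]

/-- A Hermitian matrix whose square is `a ^ 2` times a projection has trace norm `tr (X ^ 2) / a`. -/
theorem mul_traceNorm_of_sq_eq [Fintype ι] [DecidableEq ι] {X : Matrix ι ι ℂ} {a : ℝ} (ha : 0 ≤ a)
    (h : (Xᴴ * X) * (Xᴴ * X) = (a ^ 2 : ℝ) • (Xᴴ * X)) :
    a * traceNorm X = (Xᴴ * X).trace.re := by
  set M := Xᴴ * X with hM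
  have hsa : IsSelfAdjoint M := Matrix.isHermitian_conjTranspose_mul_self X
  -- Comparing the two functional calculi puts the spectrum of `M` inside `{0, a ^ 2}`, where `a *
  -- √x = x`.
  have hpoly : cfc (fun x : ℝ => x * x) M = cfc (fun x : ℝ => a ^ 2 * x) M := by
    rw [cfc_mul (fun x : ℝ => x) (fun x : ℝ => x) M, cfc_const_mul (a ^ 2) (fun x : ℝ => x) M,
      cfc_id' ℝ M, h]
  have hspec := (cfc_eq_cfc_iff_eqOn (R := ℝ)).1 hpoly
  have hsqrt : a • cfc Real.sqrt M = M := by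
    rw [← cfc_const_mul a Real.sqrt M]
    conv_rhs => rw [← cfc_id' ℝ M]
    refine cfc_congr fun x hx => ?_
    have hx' : x * (x - a ^ 2) = 0 := by linarith [hspec hx]
    rcases mul_eq_zero.1 hx' with h0 | h0
    · simp [h0]
    · rw [sub_eq_zero.1 h0]
      simp only [Real.sqrt_sq ha]
      ring
  have := congrArg (fun A : Matrix ι ι ℂ => A.trace.re) hsqrt
  simpa [traceNorm, Matrix.trace_smul] using this

/-- The square of `P - Q` multiplies both `P` and `Q` by `a ^ 2`, hence also itself, and it has
trace `2 * a ^ 2`. The factor `a` is kept on the left to avoid dividing by zero when the states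
coincide up to phase. -/
theorem mul_traceDist_projector [Fintype ι] [DecidableEq ι] {φ ψ : EuclideanSpace ℂ ι}
    (hφ : ‖φ‖ = 1) (hψ : ‖ψ‖ = 1) {a : ℝ} (ha : 0 ≤ a) (haf : a ^ 2 = 1 - ‖inner ℂ φ ψ‖ ^ 2) :
    a * traceDist (projector φ) (projector ψ) = a ^ 2 := by
  set P := projector φ
  set Q := projector ψ
  have hP : P * P = P := projector_mul_self hφ
  have hQ : Q * Q = Q := projector_mul_self hψ
  have hPQP : P * Q * P = ((‖inner ℂ φ ψ‖ ^ 2 : ℝ) : ℂ) • P := projector_mul_projector_mul_self φ ψ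
  have hQPQ : Q * P * Q = ((‖inner ℂ φ ψ‖ ^ 2 : ℝ) : ℂ) • Q := by
    rw [← norm_inner_symm]; exact projector_mul_projector_mul_self ψ φ
  have hM : (P - Q)ᴴ * (P - Q) = P + Q - P * Q - Q * P := by
    rw [Matrix.conjTranspose_sub, isHermitian_projector, isHermitian_projector]
    change (P - Q) * (P - Q) = _
    rw [sub_mul, mul_sub, mul_sub, hP, hQ]; abel
  have hf : ((a ^ 2 : ℝ) : ℂ) = 1 - ((‖inner ℂ φ ψ‖ ^ 2 : ℝ) : ℂ) := by
    rw [haf]; push_cast; ring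
  have hMP : (P + Q - P * Q - Q * P) * P = ((a ^ 2 : ℝ) : ℂ) • P := by
    simp only [sub_mul, add_mul, mul_assoc Q P P, hPQP, hP]
    rw [hf, sub_smul, one_smul]; abel
  have hMQ : (P + Q - P * Q - Q * P) * Q = ((a ^ 2 : ℝ) : ℂ) • Q := by
    simp only [sub_mul, add_mul, mul_assoc P Q Q, hQPQ, hQ]
    rw [hf, sub_smul, one_smul]; abel
  have hMM : ((P - Q)ᴴ * (P - Q)) * ((P - Q)ᴴ * (P - Q)) =
      (a ^ 2 : ℝ) • ((P - Q)ᴴ * (P - Q)) := by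
    rw [hM]
    generalize hR : P + Q - P * Q - Q * P = R at hMP hMQ
    nth_rewrite 2 [← hR]
    rw [mul_sub, mul_sub, mul_add, ← mul_assoc, ← mul_assoc, hMP, hMQ, Matrix.smul_mul,
      Matrix.smul_mul, ← Complex.coe_smul (a ^ 2), ← hR, smul_sub, smul_sub, smul_add]
  have key := mul_traceNorm_of_sq_eq ha hMM
  have htr : ((P - Q)ᴴ * (P - Q)).trace.re = 2 * a ^ 2 := by
    rw [hM, Matrix.trace_sub, Matrix.trace_sub, Matrix.trace_add, trace_projector hφ,
      trace_projector hψ, trace_projector_mul_projector, trace_projector_mul_projector,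
      norm_inner_symm ψ φ, haf]
    simp only [Complex.sub_re, Complex.add_re, Complex.one_re, Complex.ofReal_re]
    ring
  rw [htr] at key
  rw [traceDist]
  linarith

/-- States at trace distance at most `ε` have fidelity at least `1 - ε ^ 2`. -/
theorem one_sub_sq_le_of_traceDist_le [Fintype ι] [DecidableEq ι] {φ ψ : EuclideanSpace ℂ ι}
    (hφ : ‖φ‖ = 1) (hψ : ‖ψ‖ = 1) {ε : ℝ} (hε : 0 ≤ ε)
    (h : traceDist (projector φ) (projector ψ) ≤ ε) :
    1 - ε ^ 2 ≤ ‖inner ℂ φ ψ‖ ^ 2 := by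
  have hle : ‖inner ℂ φ ψ‖ ≤ 1 := by simpa [hφ, hψ] using norm_inner_le_norm (𝕜 := ℂ) φ ψ
  have h0 : 0 ≤ 1 - ‖inner ℂ φ ψ‖ ^ 2 := by nlinarith [norm_nonneg (inner ℂ φ ψ)]
  have hsq := Real.sq_sqrt h0
  have key := mul_traceDist_projector hφ hψ (Real.sqrt_nonneg _) hsq
  set a := √(1 - ‖inner ℂ φ ψ‖ ^ 2)
  rcases (Real.sqrt_nonneg (1 - ‖inner ℂ φ ψ‖ ^ 2)).eq_or_lt with ha | ha
  -- Here `key` reads `0 = 0`, but the fidelity is already 1.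
  · have : a = 0 := ha.symm
    rw [this] at hsq
    nlinarith
  · have ha' : 0 < a := ha
    have : traceDist (projector φ) (projector ψ) = a := by
      have : a * traceDist (projector φ) (projector ψ) = a * a := by rw [key]; ring
      exact mul_left_cancel₀ ha'.ne' this
    nlinarith

end States

/-! ### Hoeffding's inequality for random signs. -/

open MeasureTheory

/-- The real sign attached to a bit. -/
def bitSign (b : Bool) : ℝ := if b then 1 else -1

theorem sum_exp_signs {ι : Type*} [Fintype ι] [DecidableEq ι] (b : ι → ℝ) :
    ∑ s : ι → Bool, Real.exp (∑ i, bitSign (s i) * b i) =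
      2 ^ Fintype.card ι * ∏ i, Real.cosh (b i) := by
  have h := Finset.prod_univ_sum (fun _ : ι => (Finset.univ : Finset Bool))
    (fun i t => Real.exp (bitSign t * b i))
  rw [Fintype.piFinset_univ] at h
  simp only [Real.exp_sum]
  rw [← h, ← Finset.card_univ, ← Finset.prod_const, ← Finset.prod_mul_distrib]
  refine Finset.prod_congr rfl fun i _ => ?_
  rw [Real.cosh_eq]
  simp [bitSign]
  ring

/-- Hoeffding's inequality for Rademacher sums, in counting form. -/
theorem card_signs_le {ι : Type*} [Fintype ι] [DecidableEq ι] (b : ι → ℝ)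
    (hb : ∑ i, b i ^ 2 ≤ 1) {x : ℝ} (hx : 0 ≤ x) :
    (((Finset.univ : Finset (ι → Bool)).filter
      fun s => x ≤ ∑ i, bitSign (s i) * b i).card : ℝ) ≤
      2 ^ Fintype.card ι * Real.exp (-(x ^ 2 / 2)) := by
  -- Exponential Markov inequality with the optimal parameter, equal to the threshold `x` itself.
  have h1 : (((Finset.univ : Finset (ι → Bool)).filter
      fun s => x ≤ ∑ i, bitSign (s i) * b i).card : ℝ) * Real.exp (x * x) ≤
      ∑ s : ι → Bool, Real.exp (∑ i, bitSign (s i) * (x * b i)) := by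
    rw [← nsmul_eq_mul, ← Finset.sum_const]
    refine (Finset.sum_le_sum fun s hs => ?_).trans
      (Finset.sum_le_sum_of_subset_of_nonneg (Finset.filter_subset _ _)
        fun _ _ _ => (Real.exp_pos _).le)
    have hs' := (Finset.mem_filter.1 hs).2
    rw [Real.exp_le_exp]
    calc x * x ≤ x * ∑ i, bitSign (s i) * b i := by gcongr
      _ = _ := by rw [Finset.mul_sum]; exact Finset.sum_congr rfl fun i _ => by ring
  have h2 : ∏ i, Real.cosh (x * b i) ≤ Real.exp (x ^ 2 / 2) := by
    calc ∏ i, Real.cosh (x * b i) ≤ ∏ i, Real.exp ((x * b i) ^ 2 / 2) :=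
          Finset.prod_le_prod (fun i _ => (Real.cosh_pos _).le)
            fun i _ => Real.cosh_le_exp_half_sq _
      _ = Real.exp (x ^ 2 / 2 * ∑ i, b i ^ 2) := by
          rw [← Real.exp_sum, Finset.mul_sum]
          congr 1
          exact Finset.sum_congr rfl fun i _ => by ring
      _ ≤ _ := by
          rw [Real.exp_le_exp]
          exact mul_le_of_le_one_right (by positivity) hb
  rw [sum_exp_signs] at h1
  have h3 : Real.exp (-(x ^ 2 / 2)) = Real.exp (x ^ 2 / 2) / Real.exp (x * x) := by
    rw [← Real.exp_sub]; congr 1; ring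
  rw [h3, ← mul_div_assoc, le_div_iff₀ (Real.exp_pos _)]
  exact h1.trans (by gcongr)

/-! ### Overlap of a Haar-random state with a fixed state. -/

section Haar

variable {ι : Type*} [Fintype ι]

theorem applyUnitary_mul [DecidableEq ι] (U V : Matrix.unitaryGroup ι ℂ) (ψ : EuclideanSpace ℂ ι) :
    applyUnitary (U * V) ψ = applyUnitary U (applyUnitary V ψ) := by
  simp [applyUnitary]

theorem inner_applyUnitary_left [DecidableEq ι] (U : Matrix.unitaryGroup ι ℂ) (φ ψ : EuclideanSpace ℂ ι) :
    inner ℂ (applyUnitary U φ) ψ = inner ℂ φ (applyUnitary U⁻¹ ψ) := by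
  rw [EuclideanSpace.inner_eq_star_dotProduct, EuclideanSpace.inner_eq_star_dotProduct]
  simp only [applyUnitary, Matrix.star_mulVec, Matrix.UnitaryGroup.inv_val]
  rw [dotProduct_comm, ← Matrix.dotProduct_mulVec, dotProduct_comm]
  rfl

theorem norm_applyUnitary [DecidableEq ι] (U : Matrix.unitaryGroup ι ℂ) (ψ : EuclideanSpace ℂ ι) :
    ‖applyUnitary U ψ‖ = ‖ψ‖ := by
  have h : inner ℂ (applyUnitary U ψ) (applyUnitary U ψ) = inner ℂ ψ ψ := by
    rw [inner_applyUnitary_left, ← applyUnitary_mul, inv_mul_cancel]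
    simp [applyUnitary]
  rw [norm_eq_sqrt_re_inner (𝕜 := ℂ), h, ← norm_eq_sqrt_re_inner (𝕜 := ℂ)]

theorem continuous_inner_applyUnitary [DecidableEq ι] (φ ψ : EuclideanSpace ℂ ι) :
    Continuous fun U : Matrix.unitaryGroup ι ℂ => inner ℂ φ (applyUnitary U ψ) := by
  unfold applyUnitary
  refine Continuous.inner continuous_const ?_
  refine (PiLp.continuous_toLp 2 _).comp ?_
  exact Continuous.matrix_mulVec continuous_subtype_val continuous_const

theorem exists_applyUnitary_single [DecidableEq ι] {φ : EuclideanSpace ℂ ι} (hφ : ‖φ‖ = 1) (i : ι) :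
    ∃ U : Matrix.unitaryGroup ι ℂ, applyUnitary U (EuclideanSpace.single i 1) = φ := by
  -- A basis with `φ` in position `i` gives a unitary whose column `i` is `φ`.
  obtain ⟨b, hb⟩ := Orthonormal.exists_orthonormalBasis_extension_of_card_eq (𝕜 := ℂ)
    (E := EuclideanSpace ℂ ι) (by simp) (v := fun _ : ι => φ) (s := {i})
    (by
      constructor
      · intro _; exact hφ
      · intro a c hac; exact absurd (Subsingleton.elim a c) hac)
  refine ⟨⟨_, (EuclideanSpace.basisFun ι ℂ).toMatrix_orthonormalBasis_mem_unitary b⟩, ?_⟩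
  ext j
  have := hb i rfl
  simp [applyUnitary, Module.Basis.toMatrix_apply, this]

theorem exists_applyUnitary_eq [DecidableEq ι] [Nonempty ι] {φ χ : EuclideanSpace ℂ ι}
    (hφ : ‖φ‖ = 1) (hχ : ‖χ‖ = 1) :
    ∃ U : Matrix.unitaryGroup ι ℂ, applyUnitary U χ = φ := by
  obtain ⟨i⟩ := ‹Nonempty ι›
  obtain ⟨V, rfl⟩ := exists_applyUnitary_single hφ i
  obtain ⟨W, rfl⟩ := exists_applyUnitary_single hχ i
  exact ⟨V * W⁻¹, by rw [← applyUnitary_mul, inv_mul_cancel_right]⟩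

/-- The law of the overlap of a Haar-random state with a fixed state does not depend on the
latter. -/
theorem haarUnitary_inner_congr [DecidableEq ι] [Nonempty ι] {φ χ : EuclideanSpace ℂ ι}
    (hφ : ‖φ‖ = 1) (hχ : ‖χ‖ = 1) (ψ : EuclideanSpace ℂ ι) (S : Set ℂ) :
    haarUnitary ι {U | inner ℂ φ (applyUnitary U ψ) ∈ S} =
      haarUnitary ι {U | inner ℂ χ (applyUnitary U ψ) ∈ S} := by
  obtain ⟨V, rfl⟩ := exists_applyUnitary_eq hφ hχ
  have : (haarUnitary ι).IsMulLeftInvariant := by unfold haarUnitary; infer_instance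
  rw [← measure_preimage_mul (haarUnitary ι) V⁻¹ {U | inner ℂ χ (applyUnitary U ψ) ∈ S}]
  congr 1
  ext U
  simp [inner_applyUnitary_left, applyUnitary_mul]

/-- The flat state with the given signs. -/
noncomputable def signState (s : ι → Bool) : EuclideanSpace ℂ ι :=
  WithLp.toLp 2 fun i => ((bitSign (s i) / √(Fintype.card ι) : ℝ) : ℂ)

theorem norm_signState [Nonempty ι] (s : ι → Bool) : ‖signState s‖ = 1 := by
  have h : ∀ i, ‖((bitSign (s i) / √(Fintype.card ι) : ℝ) : ℂ)‖ ^ 2 = 1 / Fintype.card ι := by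
    intro i
    rw [Complex.norm_real, Real.norm_eq_abs, sq_abs, div_pow, Real.sq_sqrt (by positivity)]
    cases s i <;> simp [bitSign]
  rw [EuclideanSpace.norm_eq]
  simp only [signState, h]
  simp

theorem re_mul_inner_signState (s : ι → Bool) (k : ℂ) (ψ : EuclideanSpace ℂ ι) :
    (k * inner ℂ (signState s) ψ).re =
      (∑ i, bitSign (s i) * (k * ψ i).re) / √(Fintype.card ι) := by
  rw [PiLp.inner_apply, Finset.mul_sum, Complex.re_sum, Finset.sum_div]
  refine Finset.sum_congr rfl fun i _ => ?_
  simp only [signState, RCLike.inner_apply, Complex.conj_ofReal]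
  rw [← mul_assoc, mul_comm _ (Complex.ofReal _), Complex.re_ofReal_mul]
  ring

/-- Double counting of pairs `(s, U)`: by invariance every sign state gives the same measure, while
for each fixed `U` Hoeffding bounds the number of bad signs. Integrating over `U` and cancelling the
number of sign patterns leaves the bound. -/
theorem haarUnitary_le_re_inner [DecidableEq ι] [Nonempty ι] {φ ψ : EuclideanSpace ℂ ι}
    (hφ : ‖φ‖ = 1) (hψ : ‖ψ‖ = 1) {k : ℂ} (hk : ‖k‖ = 1) {x : ℝ} (hx : 0 ≤ x) :
    haarUnitary ι {U | x ≤ (k * inner ℂ φ (applyUnitary U ψ)).re} ≤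
      ENNReal.ofReal (Real.exp (-(x ^ 2 * Fintype.card ι / 2))) := by
  set A : (ι → Bool) → Set (Matrix.unitaryGroup ι ℂ) :=
    fun s => {U | x ≤ (k * inner ℂ (signState s) (applyUnitary U ψ)).re} with hA
  have hmeas : ∀ s, MeasurableSet (A s) := fun s =>
    (isClosed_le continuous_const (Complex.continuous_re.comp
      (continuous_const.mul (continuous_inner_applyUnitary _ _)))).measurableSet
  have heq : ∀ s, haarUnitary ι (A s) =
      haarUnitary ι {U | x ≤ (k * inner ℂ φ (applyUnitary U ψ)).re} := fun s =>
    haarUnitary_inner_congr (norm_signState s) hφ ψ {z | x ≤ (k * z).re}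
  have hcount : ∀ U, ∑ s, (A s).indicator (1 : Matrix.unitaryGroup ι ℂ → ENNReal) U ≤
      2 ^ Fintype.card ι * ENNReal.ofReal (Real.exp (-(x ^ 2 * Fintype.card ι / 2))) := by
    intro U
    have hD : (0 : ℝ) < √(Fintype.card ι) := Real.sqrt_pos.2 (by exact_mod_cast Fintype.card_pos)
    -- Taking real parts after the phase `k` can only shrink the amplitudes of a unit vector, so
    -- Hoeffding applies with variance at most 1.
    have hb : ∑ i, ((k * applyUnitary U ψ i).re) ^ 2 ≤ 1 := by
      have h1 : ∑ i, ‖applyUnitary U ψ i‖ ^ 2 = 1 := by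
        rw [← EuclideanSpace.norm_sq_eq, norm_applyUnitary, hψ, one_pow]
      rw [← h1]
      refine Finset.sum_le_sum fun i _ => ?_
      rw [← sq_abs]
      gcongr
      refine (Complex.abs_re_le_norm _).trans_eq ?_
      rw [norm_mul, hk, one_mul]
    have h := card_signs_le _ hb (mul_nonneg hx hD.le)
    rw [mul_pow, Real.sq_sqrt (Nat.cast_nonneg _)] at h
    have hsum : ∑ s, (A s).indicator (1 : Matrix.unitaryGroup ι ℂ → ENNReal) U =
        (((Finset.univ : Finset (ι → Bool)).filter fun s =>
          x * √(Fintype.card ι) ≤ ∑ i, bitSign (s i) * (k * applyUnitary U ψ i).re).card :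
            ENNReal) := by
      rw [Finset.card_filter, Nat.cast_sum]
      refine Finset.sum_congr rfl fun s _ => ?_
      have hiff : U ∈ A s ↔
          x * √(Fintype.card ι) ≤ ∑ i, bitSign (s i) * (k * applyUnitary U ψ i).re := by
        rw [hA, Set.mem_ofPred_eq, re_mul_inner_signState, le_div_iff₀ hD]
      by_cases hU : U ∈ A s
      · rw [Set.indicator_of_mem hU, if_pos (hiff.1 hU)]; simp
      · rw [Set.indicator_of_notMem hU, if_neg (mt hiff.2 hU)]; simp
    rw [hsum, ← ENNReal.ofReal_natCast]
    refine (ENNReal.ofReal_le_ofReal h).trans_eq ?_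
    rw [ENNReal.ofReal_mul (by positivity), ENNReal.ofReal_pow (by norm_num)]
    norm_num
  have htotal : 2 ^ Fintype.card ι *
      haarUnitary ι {U | x ≤ (k * inner ℂ φ (applyUnitary U ψ)).re} ≤
      2 ^ Fintype.card ι * ENNReal.ofReal (Real.exp (-(x ^ 2 * Fintype.card ι / 2))) := by
    calc _ = ∑ s, haarUnitary ι (A s) := by simp [heq]
      _ = ∫⁻ U, ∑ s, (A s).indicator 1 U ∂haarUnitary ι := by
          rw [lintegral_finsetSum _ fun s _ => measurable_one.indicator (hmeas s)]
          exact Finset.sum_congr rfl fun s _ => (lintegral_indicator_one (hmeas s)).symm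
      _ ≤ ∫⁻ _, 2 ^ Fintype.card ι *
            ENNReal.ofReal (Real.exp (-(x ^ 2 * Fintype.card ι / 2))) ∂haarUnitary ι :=
          lintegral_mono hcount
      _ = _ := by rw [lintegral_const, measure_univ, mul_one]
  exact (ENNReal.mul_le_mul_iff_right (by positivity) (by finiteness)).1 htotal

/-- The four real parts are `±z.re` and `±z.im`, and one of the two squares is at least half of `‖z‖
^ 2`. This reduces moduli to real parts at the price of a factor 4 and of `√2` in the threshold. -/
theorem exists_fourth_root_re_ge (z : ℂ) : ∃ j : Fin 4, ‖z‖ / √2 ≤ (Complex.I ^ (j : ℕ) * z).re := by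
  have h2 : (0 : ℝ) < √2 := by positivity
  by_contra! hcon
  have h0 := hcon 0
  have h1 := hcon 1
  have h2' := hcon 2
  have h3 := hcon 3
  simp [pow_succ, lt_div_iff₀ h2] at h0 h1 h2' h3
  have hn : ‖z‖ ^ 2 = z.re ^ 2 + z.im ^ 2 := by
    rw [← Complex.normSq_eq_norm_sq, Complex.normSq_apply]; ring
  have hs : √2 ^ 2 = 2 := Real.sq_sqrt (by norm_num)
  have hre : (z.re * √2) ^ 2 < ‖z‖ ^ 2 := sq_lt_sq' (by linarith) h0
  have him : (z.im * √2) ^ 2 < ‖z‖ ^ 2 := sq_lt_sq' (by linarith) (by linarith)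
  rw [mul_pow, hs] at hre him
  linarith

/-- Exponential tail bound for the overlap of a Haar-random state with a fixed state. -/
theorem haarUnitary_le_norm_inner [DecidableEq ι] [Nonempty ι] {φ ψ : EuclideanSpace ℂ ι}
    (hφ : ‖φ‖ = 1) (hψ : ‖ψ‖ = 1) {x : ℝ} (hx : 0 ≤ x) :
    haarUnitary ι {U | x ≤ ‖inner ℂ φ (applyUnitary U ψ)‖} ≤
      4 * ENNReal.ofReal (Real.exp (-(x ^ 2 * Fintype.card ι / 4))) := by
  have hsub : {U | x ≤ ‖inner ℂ φ (applyUnitary U ψ)‖} ⊆ ⋃ j : Fin 4,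
      {U | x / √2 ≤ (Complex.I ^ (j : ℕ) * inner ℂ φ (applyUnitary U ψ)).re} := by
    intro U hU
    obtain ⟨j, hj⟩ := exists_fourth_root_re_ge (inner ℂ φ (applyUnitary U ψ))
    exact Set.mem_iUnion.2 ⟨j, (div_le_div_of_nonneg_right hU (by positivity)).trans hj⟩
  refine (measure_mono hsub).trans ((measure_iUnion_fintype_le _ _).trans ?_)
  refine (Finset.sum_le_sum fun (j : Fin 4) _ => haarUnitary_le_re_inner hφ hψ
    (k := Complex.I ^ (j : ℕ)) (by simp) (by positivity : 0 ≤ x / √2)).trans_eq ?_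
  rw [div_pow, Real.sq_sqrt (by norm_num)]
  simp only [Finset.sum_const, Finset.card_univ, Fintype.card_fin, nsmul_eq_mul]
  congr 4
  ring_nf

end Haar

/-! ### Nets of unit vectors and of product states. -/

theorem norm_tensorState {n d : ℕ} (φ : Fin n → EuclideanSpace ℂ (Fin d)) :
    ‖tensorState φ‖ = ∏ i, ‖φ i‖ := by
  rw [← sq_eq_sq₀ (norm_nonneg _) (Finset.prod_nonneg fun _ _ => norm_nonneg _),
    EuclideanSpace.norm_sq_eq, ← Finset.prod_pow]
  simp only [EuclideanSpace.norm_sq_eq]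
  rw [Finset.prod_univ_sum, Fintype.piFinset_univ]
  refine Finset.sum_congr rfl fun x _ => ?_
  simp [tensorState, norm_prod, Finset.prod_pow]

/-- The tensor product of states as a multilinear map. -/
noncomputable def tensorStateMultilinear (n d : ℕ) :
    MultilinearMap ℂ (fun _ : Fin n => EuclideanSpace ℂ (Fin d)) (QuditSpace n d) :=
  (WithLp.linearEquiv 2 ℂ ((Fin n → Fin d) → ℂ)).symm.toLinearMap.compMultilinearMap
    (MultilinearMap.pi fun x => (MultilinearMap.mkPiAlgebra ℂ (Fin n) ℂ).compLinearMap
      fun i => PiLp.projₗ 2 (fun _ : Fin d => ℂ) (x i))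

theorem tensorStateMultilinear_apply {n d : ℕ} (φ : Fin n → EuclideanSpace ℂ (Fin d)) :
    tensorStateMultilinear n d φ = tensorState φ := by
  ext x
  simp [tensorStateMultilinear, tensorState]

/-- The tensor product is Lipschitz on tuples of unit vectors. -/
theorem norm_tensorState_sub_le {n d : ℕ} {φ χ : Fin n → EuclideanSpace ℂ (Fin d)}
    (hφ : ∀ i, ‖φ i‖ = 1) (hχ : ∀ i, ‖χ i‖ = 1) {δ : ℝ} (hδ : 0 ≤ δ)
    (h : ∀ i, ‖φ i - χ i‖ ≤ δ) : ‖tensorState φ - tensorState χ‖ ≤ n * δ := by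
  have := (tensorStateMultilinear n d).norm_image_sub_le_of_bound zero_le_one
    (fun m => by
      rw [one_mul, tensorStateMultilinear_apply, norm_tensorState]) φ χ
  simp only [tensorStateMultilinear_apply] at this
  refine this.trans ?_
  rw [one_mul, Fintype.card_fin]
  have h1 : max ‖φ‖ ‖χ‖ ≤ 1 := max_le
    ((pi_norm_le_iff_of_nonneg zero_le_one).2 fun i => (hφ i).le)
    ((pi_norm_le_iff_of_nonneg zero_le_one).2 fun i => (hχ i).le)
  have h2 : ‖φ - χ‖ ≤ δ := (pi_norm_le_iff_of_nonneg hδ).2 h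
  have h3 : max ‖φ‖ ‖χ‖ ^ (n - 1) ≤ 1 := pow_le_one₀ (le_max_of_le_left (norm_nonneg _)) h1
  calc (n : ℝ) * max ‖φ‖ ‖χ‖ ^ (n - 1) * ‖φ - χ‖ ≤ n * 1 * δ := by gcongr
    _ = _ := by ring

theorem norm_le_sum_norm {d : ℕ} (v : EuclideanSpace ℂ (Fin d)) : ‖v‖ ≤ ∑ i, ‖v i‖ := by
  rw [EuclideanSpace.norm_eq]
  exact Real.sqrt_le_iff.2 ⟨by positivity, Finset.sum_sq_le_sq_sum_of_nonneg fun _ _ => norm_nonneg _⟩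

/-- The grid cell of a number in `[-1, 1]`, at mesh `2 / K`. -/
noncomputable def gridCell (K : ℕ) (x : ℝ) : Fin (K + 1) :=
  Fin.ofNat (K + 1) ⌊(x + 1) / 2 * K⌋₊

theorem abs_sub_le_of_gridCell_eq {K : ℕ} (hK : 0 < K) {x y : ℝ} (hx : |x| ≤ 1) (hy : |y| ≤ 1)
    (h : gridCell K x = gridCell K y) : |x - y| ≤ 2 / K := by
  have hK' : (0 : ℝ) < K := by exact_mod_cast hK
  have key : ∀ z : ℝ, |z| ≤ 1 →
      -- The endpoint `z = 1` has floor exactly `K`; with `K + 1` cells the reduction in `Fin.ofNat`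
      -- never wraps around.
      0 ≤ (z + 1) / 2 * K ∧ ⌊(z + 1) / 2 * K⌋₊ % (K + 1) = ⌊(z + 1) / 2 * K⌋₊ := by
    intro z hz
    obtain ⟨h1, h2⟩ := abs_le.1 hz
    refine ⟨mul_nonneg (by linarith) hK'.le, Nat.mod_eq_of_lt (Nat.lt_succ_of_le ?_)⟩
    refine Nat.floor_le_of_le ?_
    exact mul_le_of_le_one_left hK'.le (by linarith)
  obtain ⟨hx0, hx1⟩ := key x hx
  obtain ⟨hy0, hy1⟩ := key y hy
  have hfl : ⌊(x + 1) / 2 * K⌋₊ = ⌊(y + 1) / 2 * K⌋₊ := by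
    rw [← hx1, ← hy1]; exact congrArg Fin.val h
  have h1 := Nat.floor_le hx0
  have h2 := Nat.lt_floor_add_one ((x + 1) / 2 * K)
  have h3 := Nat.floor_le hy0
  have h4 := Nat.lt_floor_add_one ((y + 1) / 2 * K)
  rw [hfl] at h1 h2
  rw [abs_le, neg_le, le_div_iff₀ hK', le_div_iff₀ hK']
  constructor <;> linarith

/-- A finite net of unit vectors, indexed by grid cells. -/
theorem exists_unit_net {d K : ℕ} (hd : 0 < d) (hK : 0 < K) :
    ∃ r : (Fin d → Fin (K + 1) × Fin (K + 1)) → EuclideanSpace ℂ (Fin d),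
      (∀ c, ‖r c‖ = 1) ∧ ∀ v, ‖v‖ = 1 → ∃ c, ‖v - r c‖ ≤ d * (4 / K) := by
  classical
  let cell : EuclideanSpace ℂ (Fin d) → Fin d → Fin (K + 1) × Fin (K + 1) :=
    fun v i => (gridCell K (v i).re, gridCell K (v i).im)
  have hex : ∀ c, ∃ w : EuclideanSpace ℂ (Fin d), ‖w‖ = 1 ∧
      ((∃ v, ‖v‖ = 1 ∧ cell v = c) → cell w = c) := by
    intro c
    by_cases h : ∃ v, ‖v‖ = 1 ∧ cell v = c
    · obtain ⟨v, hv, hc⟩ := h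
      exact ⟨v, hv, fun _ => hc⟩
    · exact ⟨EuclideanSpace.single ⟨0, hd⟩ 1, by simp, fun h' => absurd h' h⟩
  choose r hr hcell using hex
  refine ⟨r, hr, fun v hv => ⟨cell v, ?_⟩⟩
  have hc := hcell (cell v) ⟨v, hv, rfl⟩
  refine (norm_le_sum_norm _).trans ?_
  have hbound : ∀ i, ‖(v - r (cell v)) i‖ ≤ 4 / K := by
    intro i
    have hvi : ‖v i‖ ≤ 1 := hv ▸ PiLp.norm_apply_le v i
    have hri : ‖r (cell v) i‖ ≤ 1 := hr (cell v) ▸ PiLp.norm_apply_le (r (cell v)) i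
    have hci := congrFun hc i
    have hre := abs_sub_le_of_gridCell_eq hK ((Complex.abs_re_le_norm _).trans hvi)
      ((Complex.abs_re_le_norm _).trans hri) (congrArg Prod.fst hci).symm
    have him := abs_sub_le_of_gridCell_eq hK ((Complex.abs_im_le_norm _).trans hvi)
      ((Complex.abs_im_le_norm _).trans hri) (congrArg Prod.snd hci).symm
    refine (Complex.norm_le_abs_re_add_abs_im _).trans ?_
    rw [PiLp.sub_apply, Complex.sub_re, Complex.sub_im]
    refine (add_le_add hre him).trans_eq ?_
    ring
  refine (Finset.sum_le_sum fun i _ => hbound i).trans_eq ?_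
  simp

/-- The net size is subexponential in the dimension `d ^ n`. -/
theorem exists_net_card_le (A : ℕ) {c : ℝ} (hc : 0 < c) :
    ∃ N : ℕ, ∀ d n : ℕ, 2 ≤ d → 2 ≤ n → N ≤ d ^ n →
      4 * ((A * (d * n) + 1 : ℕ) : ℝ) ^ (2 * (d * n)) ≤ Real.exp (c * (d : ℝ) ^ n) := by
  have hη : 0 < √c / 4 := by positivity
  -- With `x = d ^ n`, the logarithm of the net size is at most `8 * √x * log x ^ 2`, using `d ≤ √x`
  -- (from `2 ≤ n`), `n ≤ 2 * log x` and base at most `x ^ 2`. The constant `√c / 4` and exponent `1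
  -- / 4` make this at most `c * x / 2`; the other half of `c * x` absorbs `log 4`.
  have hev : ∀ᶠ x : ℝ in Filter.atTop, Real.log x ≤ √c / 4 * x ^ (1 / 4 : ℝ) := by
    filter_upwards [(isLittleO_log_rpow_atTop (by norm_num : (0 : ℝ) < 1 / 4)).bound hη,
      Filter.eventually_ge_atTop 0] with x hx hx0
    rw [Real.norm_of_nonneg (Real.rpow_nonneg hx0 _)] at hx
    exact (le_abs_self _).trans hx
  obtain ⟨B, hB⟩ := Filter.eventually_atTop.1 (hev.and ((Filter.eventually_ge_atTop ((A : ℝ) + 1)).and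
    (Filter.eventually_ge_atTop (4 / c))))
  refine ⟨⌈B⌉₊, fun d n hd hn hN => ?_⟩
  have hBx : B ≤ (d : ℝ) ^ n := by exact_mod_cast Nat.ceil_le.1 hN
  obtain ⟨h1, h2, h3⟩ := hB _ hBx
  have hd0 : (2 : ℝ) ≤ d := by exact_mod_cast hd
  have hn0 : (2 : ℝ) ≤ n := by exact_mod_cast hn
  have hdn : d * n ≤ d ^ n := by
    obtain ⟨m, rfl⟩ : ∃ m, n = m + 1 := ⟨n - 1, by omega⟩
    rw [pow_succ, mul_comm]
    exact Nat.mul_le_mul_right _ (Nat.lt_pow_self (by omega))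
  have hdn' : (d : ℝ) * n ≤ (d : ℝ) ^ n := by exact_mod_cast hdn
  have hsqrt : (d : ℝ) ≤ √((d : ℝ) ^ n) :=
    Real.le_sqrt_of_sq_le (pow_le_pow_right₀ (by linarith) hn)
  have hnlog : (n : ℝ) ≤ 2 * Real.log ((d : ℝ) ^ n) := by
    rw [Real.log_pow]
    have : Real.log 2 ≤ Real.log d := Real.log_le_log (by norm_num) hd0
    nlinarith [Real.log_two_gt_d9]
  set x := (d : ℝ) ^ n with hx
  have hx1 : 1 ≤ x := one_le_pow₀ (by linarith)
  have hx0 : 0 < x := by linarith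
  have hlogx : 0 ≤ Real.log x := Real.log_nonneg hx1
  have hbase : ((A * (d * n) + 1 : ℕ) : ℝ) ≤ x * x := by
    push_cast
    calc (A : ℝ) * (d * n) + 1 ≤ A * x + x := by gcongr
      _ = (A + 1) * x := by ring
      _ ≤ x * x := by gcongr
  have hlogbase : Real.log ((A * (d * n) + 1 : ℕ) : ℝ) ≤ 2 * Real.log x := by
    refine (Real.log_le_log (by positivity) hbase).trans_eq ?_
    rw [Real.log_mul hx0.ne' hx0.ne']; ring
  have hsq : Real.log x ^ 2 ≤ c / 16 * √x := by
    calc Real.log x ^ 2 ≤ (√c / 4 * x ^ (1 / 4 : ℝ)) ^ 2 := by gcongr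
      _ = √c ^ 2 / 16 * (x ^ (1 / 4 : ℝ)) ^ 2 := by ring
      _ = _ := by
        rw [Real.sq_sqrt hc.le, ← Real.rpow_natCast (x ^ (1 / 4 : ℝ)), ← Real.rpow_mul hx0.le,
          Real.sqrt_eq_rpow]
        norm_num
  have hmain : Real.log 4 + (2 * (d * n) : ℕ) * Real.log ((A * (d * n) + 1 : ℕ) : ℝ) ≤ c * x := by
    have h4 : Real.log 4 ≤ 2 := by
      have : Real.log 4 = 2 * Real.log 2 := by
        rw [show (4 : ℝ) = 2 ^ 2 by norm_num, Real.log_pow]; norm_num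
      linarith [Real.log_two_lt_d9]
    have h5 : 2 ≤ c * x / 2 := by
      rw [div_le_iff₀ hc] at h3; linarith
    have h6 : ((2 * (d * n) : ℕ) : ℝ) * Real.log ((A * (d * n) + 1 : ℕ) : ℝ) ≤ c * x / 2 := by
      calc ((2 * (d * n) : ℕ) : ℝ) * Real.log ((A * (d * n) + 1 : ℕ) : ℝ)
          ≤ (2 * (√x * (2 * Real.log x))) * (2 * Real.log x) := by
            have h0 : 0 ≤ Real.log ((A * (d * n) + 1 : ℕ) : ℝ) := Real.log_natCast_nonneg _
            have h7 : ((2 * (d * n) : ℕ) : ℝ) ≤ 2 * (√x * (2 * Real.log x)) := by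
              push_cast
              gcongr
            exact mul_le_mul h7 hlogbase h0 (by positivity)
        _ = 8 * √x * Real.log x ^ 2 := by ring
        _ ≤ 8 * √x * (c / 16 * √x) := by gcongr
        _ = c / 2 * (√x * √x) := by ring
        _ = c * x / 2 := by rw [Real.mul_self_sqrt hx0.le]; ring
    linarith
  have hpos : (0 : ℝ) < ((A * (d * n) + 1 : ℕ) : ℝ) := by positivity
  rw [← Real.log_le_iff_le_exp (by positivity), Real.log_mul (by norm_num) (by positivity),
    Real.log_pow]
  exact hmain

end ProductTesting

/-! ### Union bound over the net. -/

theorem corollary1 (ε : ℝ) (hε0 : 0 < ε) (hε1 : ε < 1) :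
    ∃ c : ℝ, 0 < c ∧ ∃ N : ℕ, ∀ d n : ℕ, 2 ≤ d → 2 ≤ n → N ≤ d ^ n →
      ∀ ψ₀ : ProductTesting.QuditSpace n d, ‖ψ₀‖ = 1 →
        ProductTesting.haarUnitary (Fin n → Fin d)
            {U | ProductTesting.IsClose ε (ProductTesting.multipartiteProduct n d)
              (ProductTesting.applyUnitary U ψ₀)} ≤
          ENNReal.ofReal (Real.exp (-(c * (d : ℝ) ^ n))) := by
  have hs0 : 0 < 1 - ε ^ 2 := by nlinarith
  set s := √(1 - ε ^ 2) with hs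
  have hspos : 0 < s := Real.sqrt_pos.2 hs0
  -- With grid size `A * (d * n)` the total rounding error is `4 / A`, at most `s / 2`.
  obtain ⟨A, hA⟩ := exists_nat_ge (8 / s)
  have hApos : (0 : ℝ) < A := lt_of_lt_of_le (by positivity) hA
  have hA0 : 0 < A := by exact_mod_cast hApos
  -- The tail exponent at threshold `s / 2` is `s ^ 2 / 16`; half of it pays for the net and the
  -- other half is the final rate.
  have hc : 0 < s ^ 2 / 32 := by positivity
  obtain ⟨N, hN⟩ := ProductTesting.exists_net_card_le A hc
  refine ⟨s ^ 2 / 32, hc, N, fun d n hd hn hND ψ₀ hψ₀ => ?_⟩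
  have : Nonempty (Fin n → Fin d) := ⟨fun _ => ⟨0, by omega⟩⟩
  have hK : 0 < A * (d * n) := by positivity
  obtain ⟨r, hr, hnet⟩ := ProductTesting.exists_unit_net (d := d) (by omega) hK
  have hunit : ∀ c : Fin n → Fin d → Fin (A * (d * n) + 1) × Fin (A * (d * n) + 1),
      ‖ProductTesting.tensorState fun i => r (c i)‖ = 1 := fun c => by
    rw [ProductTesting.norm_tensorState]; simp [hr]
  have hsub : {U | ProductTesting.IsClose ε (ProductTesting.multipartiteProduct n d)
      (ProductTesting.applyUnitary U ψ₀)} ⊆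
      ⋃ c : Fin n → Fin d → Fin (A * (d * n) + 1) × Fin (A * (d * n) + 1),
        {U | s / 2 ≤ ‖inner ℂ (ProductTesting.tensorState fun i => r (c i))
          (ProductTesting.applyUnitary U ψ₀)‖} := by
    rintro U ⟨_, ⟨φ, hφ, rfl⟩, hclose⟩
    have hψ : ‖ProductTesting.applyUnitary U ψ₀‖ = 1 := by
      rw [ProductTesting.norm_applyUnitary, hψ₀]
    have hover := ProductTesting.one_sub_sq_le_of_traceDist_le
      (by rw [ProductTesting.norm_tensorState]; simp [hφ]) hψ hε0.le hclose
    have hover' := Real.sqrt_le_left (norm_nonneg _) |>.2 hover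
    choose c hcell using fun i => hnet (φ i) (hφ i)
    refine Set.mem_iUnion.2 ⟨c, ?_⟩
    have hdist := ProductTesting.norm_tensorState_sub_le hφ (fun i => hr (c i)) (by positivity) hcell
    have hδ : (n : ℝ) * (d * (4 / (A * (d * n) : ℕ))) ≤ s / 2 := by
      have hd' : (0 : ℝ) < d := by exact_mod_cast (by omega : 0 < d)
      have hn' : (0 : ℝ) < n := by exact_mod_cast (by omega : 0 < n)
      have : (n : ℝ) * (d * (4 / (A * (d * n) : ℕ))) = 4 / A := by
        push_cast; field_simp
      rw [this, div_le_iff₀ hApos]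
      rw [div_le_iff₀ hspos] at hA
      linarith
    have hdiff : ‖inner ℂ (ProductTesting.tensorState φ) (ProductTesting.applyUnitary U ψ₀)‖ ≤
        ‖inner ℂ (ProductTesting.tensorState fun i => r (c i))
          (ProductTesting.applyUnitary U ψ₀)‖ + s / 2 := by
      have hsplit : inner ℂ (ProductTesting.tensorState φ) (ProductTesting.applyUnitary U ψ₀) =
          inner ℂ (ProductTesting.tensorState fun i => r (c i))
            (ProductTesting.applyUnitary U ψ₀) +
          inner ℂ (ProductTesting.tensorState φ - ProductTesting.tensorState fun i => r (c i))
            (ProductTesting.applyUnitary U ψ₀) := by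
        rw [← inner_add_left]; simp
      rw [hsplit]
      refine (norm_add_le _ _).trans (add_le_add_right ?_ _)
      refine (norm_inner_le_norm _ _).trans ?_
      rw [hψ, mul_one]
      exact hdist.trans hδ
    change s / 2 ≤ _
    linarith
  refine (MeasureTheory.measure_mono hsub).trans
    ((MeasureTheory.measure_iUnion_fintype_le _ _).trans ?_)
  refine (Finset.sum_le_sum fun c _ => ProductTesting.haarUnitary_le_norm_inner (hunit c) hψ₀
    (by positivity : 0 ≤ s / 2)).trans ?_
  rw [Finset.sum_const, Finset.card_univ, nsmul_eq_mul]
  have hcard : Fintype.card (Fin n → Fin d → Fin (A * (d * n) + 1) × Fin (A * (d * n) + 1)) =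
      (A * (d * n) + 1) ^ (2 * (d * n)) := by
    simp only [Fintype.card_fun, Fintype.card_prod, Fintype.card_fin]
    rw [← sq, ← pow_mul, ← pow_mul]
  have hbound := hN d n hd hn hND
  rw [hcard, ← ENNReal.ofReal_natCast, show (4 : ENNReal) = ENNReal.ofReal 4 by simp,
    ← ENNReal.ofReal_mul (by norm_num), ← ENNReal.ofReal_mul (by positivity)]
  refine ENNReal.ofReal_le_ofReal ?_
  have hD : ((Fintype.card (Fin n → Fin d) : ℕ) : ℝ) = (d : ℝ) ^ n := by simp
  rw [hD, Nat.cast_pow, ← mul_assoc, mul_comm _ (4 : ℝ)]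
  calc _ ≤ Real.exp (s ^ 2 / 32 * (d : ℝ) ^ n) *
        Real.exp (-((s / 2) ^ 2 * (d : ℝ) ^ n / 4)) := by gcongr
    _ = _ := by rw [← Real.exp_add]; congr 1; ring
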